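/- All graphs are finite and simple. The Sombor index of a graph $G$ is $SO(G)=\sum_{uv\in E(G)}\sqrt{d_G(u)^2+d_G(v)^2}$, where $d_G(u)$ is the degree of $u$ in $G$. A unicyclic graph is a connected graph with $|V(G)|=|E(G)|$. Let $S_m$ denote the star of order $m$. For $n\ge 3$, let $Q_{n,2}$ be the graph obtained from $S_{n-1}$ by adding a new vertex joined to the centre of $S_{n-1}$ and to exactly one of its leaves (so $Q_{3,2}$ is the triangle). For $n\ge 5$, let $Q'_{n,2}$ be the graph obtained from $Q_{n-1,2}$ by adding a new vertex joined to exactly one vertex of $Q_{n-1,2}$, which has degree $2$ in $Q_{n-1,2}$, and let $Q^*_{n,2}$ be the graph obtained from $S_{n-1}$ by adding a new vertex joined to exactly two leaves of $S_{n-1}$. Let $G$ be a unicyclic graph of order $n\ge 3$. Then: (i) $SO(G)\le \sqrt{8}+(n-3)\sqrt{(n-1)^2+1}+2\sqrt{(n-1)^2+4}$, with equality if and only if $G\cong Q_{n,2}$. (ii) If $n\ge 5$ and $G\not\cong Q_{n,2}$, then $SO(G)\le \sqrt{10}+\sqrt{13}+(n-4)\sqrt{(n-2)^2+1}+\sqrt{(n-2)^2+4}+\sqrt{(n-2)^2+9}$,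 with equality if and only if $G\cong Q'_{n,2}$. (iii) If $n\ge 5$ and $G\not\cong Q_{n,2}$, $G\not\cong Q'_{n,2}$, then $SO(G)\le (n-4)\sqrt{(n-2)^2+1}+2\sqrt{(n-2)^2+4}+2\sqrt{8}$, with equality if and only if $G\cong Q^*_{n,2}$. -/

import Mathlib

/-- A unicyclic graph: a connected graph with as many edges as vertices. -/
def IsUnicyclic {V : Type*} [Fintype V] [DecidableEq V] (G : SimpleGraph V)
    [DecidableRel G.Adj] : Prop :=
  G.Connected ∧ G.edgeFinset.card = Fintype.card V

/-- The Sombor index: the sum of `√(d(u)² + d(v)²)` over all edges `uv`. -/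
noncomputable def sombor {V : Type*} [Fintype V] [DecidableEq V] (G : SimpleGraph V)
    [DecidableRel G.Adj] : ℝ :=
  ∑ e ∈ G.edgeFinset,
    Sym2.lift ⟨fun u v => √((G.degree u : ℝ) ^ 2 + (G.degree v : ℝ) ^ 2),
      fun _ _ => congrArg Real.sqrt (add_comm _ _)⟩ e

/-- `Q_{n,k}` for `1 ≤ k ≤ n - 1`, on the vertices `0, …, n - 1`. The star `S_{n-1}` has centre `0`
and leaves `1, …, n - 2`; the additional vertex `n - 1` is joined to the centre `0` and to the
`k - 1` leaves `1, …, k - 1`. (`fromRel` symmetrizes the relation and discards loops.) -/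
def graphQ (n k : ℕ) : SimpleGraph (Fin n) :=
  SimpleGraph.fromRel fun i j =>
    i.val = 0 ∨ (1 ≤ i.val ∧ i.val < k ∧ j.val + 1 = n)

/-- `Q*_{n,k}` for `1 ≤ k ≤ n - 2`, on the vertices `0, …, n - 1`. The star `S_{n-1}` has centre `0`
and leaves `1, …, n - 2`; the additional vertex `n - 1` is joined to the `k` leaves `1, …, k`. -/
def graphQStar (n k : ℕ) : SimpleGraph (Fin n) :=
  SimpleGraph.fromRel fun i j =>
    (i.val = 0 ∧ j.val + 1 < n) ∨ (1 ≤ i.val ∧ i.val ≤ k ∧ j.val + 1 = n)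

/-- `Q'_{n,2}` for `n ≥ 5`, on the vertices `0, …, n - 1`. The vertices `0, …, n - 2` carry the graph
`Q_{n-1,2}` (all of them joined to `0`, and `n - 2` joined to `1`), in which `1` has degree two;
the additional vertex `n - 1` is joined to `1` only. -/
def graphQPrimeTwo (n : ℕ) : SimpleGraph (Fin n) :=
  SimpleGraph.fromRel fun i j =>
    (i.val = 0 ∧ j.val + 1 < n) ∨ (i.val = 1 ∧ j.val + 2 = n) ∨ (i.val = 1 ∧ j.val + 1 = n)

/-! Split by the maximum degree; connectivity enters only through the absence of isolated vertices.
With `n` edges, a vertex `c` of degree `n - 1` leaves one edge avoiding `c`, so the graph is `Q`. A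
vertex of degree `n - 2` misses one vertex `w` and leaves two edges, one of them ending at `w`. The
other meets the first at its far end (`Q'`), meets it at `w` (`Q*`), or is disjoint from it, and
this last graph lies strictly below `Q*`.

If all degrees are at most `n - 3`, a crude estimate is enough. An edge bound `√(a² + b²) ≤ F a + F
b` gives `SO ≤ ∑ d F(d)` (`sombor_le_sum_degree_mul`). For the chosen `F`, `d F(d)` is `(d - 1)²`
plus an affine term and a correction at leaves. The excesses `d - 1` sum to `n`, are at most `n -
4`, and at least three are nonzero, so their squares sum to at most `(n - 4)² + 3² + 1²`. The
resulting bound is below the value of `Q*` once `n ≥ 8`; orders 5, 6 and 7 use tailored weights.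

The values satisfy `Q* < Q' < Q`, which yields all three parts. -/

/-! ### General facts on the Sombor index. -/

open Finset in
/-- Edge weights bounded by a sum of vertex weights bound the Sombor index. -/
theorem sombor_le_sum_degree_mul {V : Type*} [Fintype V] [DecidableEq V] (G : SimpleGraph V)
    [DecidableRel G.Adj] (F : ℕ → ℝ)
    (hF : ∀ u v, G.Adj u v →
      √((G.degree u : ℝ) ^ 2 + (G.degree v : ℝ) ^ 2) ≤ F (G.degree u) + F (G.degree v)) :
    sombor G ≤ ∑ v, (G.degree v : ℝ) * F (G.degree v) := by
  have h1 : sombor G ≤ ∑ e ∈ G.edgeFinset, ∑ v, if v ∈ e then F (G.degree v) else 0 := by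
    refine Finset.sum_le_sum fun e he => ?_
    induction e using Sym2.ind with
    | _ u v =>
      have huv : G.Adj u v := by simpa using he
      refine (hF u v huv).trans (le_of_eq ?_)
      rw [← Finset.sum_filter]
      have : (univ.filter fun w => w ∈ s(u, v)) = {u, v} := by ext; simp
      rw [this, Finset.sum_pair huv.ne]
  refine h1.trans (le_of_eq ?_)
  rw [Finset.sum_comm]
  refine Finset.sum_congr rfl fun v _ => ?_
  rw [← Finset.sum_filter, ← G.incidenceFinset_eq_filter, Finset.sum_const,
    G.card_incidenceFinset_eq_degree, nsmul_eq_mul]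

/-- The Sombor index splits into the contribution of the edges at `c` and the remaining edges. -/
theorem sombor_eq_sum_neighbor_add {V : Type*} [Fintype V] [DecidableEq V] (G : SimpleGraph V)
    [DecidableRel G.Adj] (c : V) :
    sombor G = ∑ v ∈ G.neighborFinset c, √((G.degree c : ℝ) ^ 2 + (G.degree v : ℝ) ^ 2) +
      ∑ e ∈ G.edgeFinset with c ∉ e,
        Sym2.lift ⟨fun u v => √((G.degree u : ℝ) ^ 2 + (G.degree v : ℝ) ^ 2),
          fun _ _ => congrArg Real.sqrt (add_comm _ _)⟩ e := by
  unfold sombor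
  rw [← Finset.sum_filter_add_sum_filter_not G.edgeFinset (fun e => c ∈ e)]
  congr 1
  have : (G.edgeFinset.filter fun e => c ∈ e) = (G.neighborFinset c).image (fun v => s(c, v)) := by
    ext e
    induction e using Sym2.ind with
    | _ u v =>
      simp only [Finset.mem_filter, SimpleGraph.mem_edgeFinset, SimpleGraph.mem_edgeSet,
        Sym2.mem_iff, Finset.mem_image, SimpleGraph.mem_neighborFinset, Sym2.eq_iff]
      constructor
      · rintro ⟨h, rfl | rfl⟩
        · exact ⟨v, h, by simp⟩
        · exact ⟨u, h.symm, by simp⟩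
      · rintro ⟨w, h, ⟨rfl, rfl⟩ | ⟨rfl, rfl⟩⟩
        · exact ⟨h, by simp⟩
        · exact ⟨h.symm, by simp⟩
  rw [this, Finset.sum_image]
  · rfl
  · intro a _ b _ h
    exact Sym2.congr_right.1 h

theorem sombor_congr {V W : Type*} [Fintype V] [DecidableEq V] [Fintype W] [DecidableEq W]
    (G : SimpleGraph V) (H : SimpleGraph W) [DecidableRel G.Adj] [DecidableRel H.Adj]
    (f : G ≃g H) : sombor G = sombor H := by
  unfold sombor
  refine Finset.sum_bij (fun e _ => Sym2.map f e) ?_ ?_ ?_ ?_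
  · intro e
    induction e using Sym2.ind with
    | _ u v => simp [f.map_adj_iff]
  · intro a _ b _ h
    exact Sym2.map.injective f.injective h
  · intro e
    induction e using Sym2.ind with
    | _ u v =>
      intro h
      exact ⟨s(f.symm u, f.symm v), by simpa [f.symm.map_adj_iff] using h, by simp⟩
  · intro e _
    induction e using Sym2.ind with
    | _ u v => simp [SimpleGraph.Iso.degree_eq]

/-! ### Degree sequences: vertices of degree at least two and sums of squared excesses. -/

/-- At least three vertices have degree two or more. -/
theorem three_le_card_two_le_degree {V : Type*} [Fintype V] [DecidableEq V] (G : SimpleGraph V)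
    [DecidableRel G.Adj] 
    (hsum : ∑ v, G.degree v = 2 * Fintype.card V) (hV : 0 < Fintype.card V) :
    3 ≤ (Finset.univ.filter fun v => G.degree v ≠ 1).card := by
  by_contra! hlt
  set A := Finset.univ.filter fun v => G.degree v ≠ 1 with hA
  have hout : ∀ v, v ∉ A → G.degree v = 1 := fun v hv => by simpa [hA] using hv
  have h1 : ∑ v ∈ A, G.degree v + (Fintype.card V - A.card) = 2 * Fintype.card V := by
    rw [← hsum, ← Finset.sum_add_sum_compl A, ← Finset.card_compl, Finset.card_eq_sum_ones]
    congr 1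
    exact Finset.sum_congr rfl fun v hv => (hout v (by simpa using hv)).symm
  have hAV : A.card ≤ Fintype.card V := Finset.card_le_univ A
  interval_cases hc : A.card
  · rw [Finset.card_eq_zero] at hc
    simp [hc] at h1
    omega
  · obtain ⟨a, ha⟩ := Finset.card_eq_one.1 hc
    have := G.degree_lt_card_verts a
    simp [ha] at h1
    omega
  · obtain ⟨a, b, hab, ha⟩ := Finset.card_eq_two.1 hc
    rw [ha, Finset.sum_pair hab] at h1
    -- A common neighbour would lie outside `A`, hence be a leaf with two neighbours. But the two
    -- degrees sum to `n + 2`, too many for disjoint neighbourhoods.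
    have hdis : Disjoint (G.neighborFinset a) (G.neighborFinset b) := by
      rw [Finset.disjoint_left]
      intro v hva hvb
      rw [SimpleGraph.mem_neighborFinset] at hva hvb
      have hv : v ∉ A := by
        rw [ha]; simp [hva.ne', hvb.ne']
      have h2 : ({a, b} : Finset V) ⊆ G.neighborFinset v := by
        intro w hw
        simp only [Finset.mem_insert, Finset.mem_singleton] at hw
        rcases hw with rfl | rfl
        · simpa using hva.symm
        · simpa using hvb.symm
      have := Finset.card_le_card h2
      rw [Finset.card_pair hab, SimpleGraph.card_neighborFinset_eq_degree, hout v hv] at this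
      omega
    have := Finset.card_le_univ (G.neighborFinset a ∪ G.neighborFinset b)
    rw [Finset.card_union_of_disjoint hdis, SimpleGraph.card_neighborFinset_eq_degree,
      SimpleGraph.card_neighborFinset_eq_degree] at this
    omega

-- By convexity the extreme case is one unit at one point and the rest at another. With `f a = 1 +
-- p` and remaining mass `1 + q`, the slack is `2pq`.
open Finset in
theorem sum_sq_le_of_two_pos {V : Type*} [DecidableEq V] (s : Finset V) (f : V → ℕ)
    (a b : V) (ha : a ∈ s) (hb : b ∈ s) (hab : a ≠ b) (hfa : 1 ≤ f a) (hfb : 1 ≤ f b) :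
    ∑ v ∈ s, f v ^ 2 ≤ (∑ v ∈ s, f v - 1) ^ 2 + 1 := by
  have h1 : ∑ v ∈ s.erase a, f v ^ 2 ≤ (∑ v ∈ s.erase a, f v) ^ 2 :=
    Finset.sum_sq_le_sq_sum_of_nonneg (fun _ _ => Nat.zero_le _)
  have h2 : f b ≤ ∑ v ∈ s.erase a, f v :=
    Finset.single_le_sum (f := f) (fun _ _ => Nat.zero_le _) (by simp [hb, hab.symm])
  rw [← Finset.add_sum_erase s _ ha, ← Finset.add_sum_erase s f ha]
  set r := ∑ v ∈ s.erase a, f v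
  obtain ⟨p, hp⟩ := Nat.exists_eq_add_of_le hfa
  obtain ⟨q, hq⟩ := Nat.exists_eq_add_of_le (hfb.trans h2)
  rw [hq] at h1 ⊢
  rw [hp]
  have : 1 + p + (1 + q) - 1 = p + q + 1 := by omega
  rw [this]
  nlinarith [Nat.zero_le (p * q)]

/-- An upper bound on the sum of squares of the excesses `d - 1`. -/
theorem sum_sq_le_of_le_sub_four {V : Type*} [Fintype V] [DecidableEq V] (f : V → ℕ) (n : ℕ)
    (hn : 7 ≤ n) (hsum : ∑ v, f v = n) (hle : ∀ v, f v + 4 ≤ n)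
    (h3 : 3 ≤ (Finset.univ.filter fun v => f v ≠ 0).card) :
    ∑ v, f v ^ 2 + 8 * n ≤ n ^ 2 + 26 := by
  have hne : Nonempty V := by
    by_contra h
    rw [not_nonempty_iff] at h
    simp at h3
  obtain ⟨c, hc⟩ := Finite.exists_max f
  have h2 : 1 < ((Finset.univ.filter fun v => f v ≠ 0).erase c).card := by
    have := Finset.pred_card_le_card_erase (s := Finset.univ.filter fun v => f v ≠ 0) (a := c)
    omega
  obtain ⟨a, ha, b, hb, hab⟩ := Finset.one_lt_card.1 h2
  simp only [Finset.mem_erase, Finset.mem_filter, Finset.mem_univ, true_and] at ha hb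
  have h4 := sum_sq_le_of_two_pos (Finset.univ.erase c) f a b (by simp [ha.1]) (by simp [hb.1]) hab
    (Nat.one_le_iff_ne_zero.2 ha.2) (Nat.one_le_iff_ne_zero.2 hb.2)
  have h5 := Finset.add_sum_erase Finset.univ f (Finset.mem_univ c)
  have h6 := Finset.add_sum_erase Finset.univ (fun v => f v ^ 2) (Finset.mem_univ c)
  have h7 : ∑ v, f v ^ 2 ≤ f c * n := by
    rw [← hsum, Finset.mul_sum]
    exact Finset.sum_le_sum fun v _ => by
      rw [sq]; exact Nat.mul_le_mul_right _ (hc v)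
  have hcn := hle c
  have h8 : ∑ v ∈ Finset.univ.erase c, f v - 1 = n - f c - 1 := by omega
  rw [h8] at h4
  rw [← h6] at h7 ⊢
  set m := f c
  set S := ∑ v ∈ Finset.univ.erase c, f v ^ 2
  -- For a large maximum, `h4` gives `m² + (n - m - 1)² + 1`, convex in `m` and extremal at `m = n -
  -- 4`; for `m = n - 4 - k` the slack is `2k(m - 3)`. For a small one, `h7` gives at most `n(n -
  -- 2)/2`, and `(n - 7)² + 3 ≥ 0` suffices.
  rcases le_or_gt n (2 * m + 1) with h | h
  · obtain ⟨k, rfl⟩ := Nat.exists_eq_add_of_le hcn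
    have : m + 4 + k - m - 1 = k + 3 := by omega
    rw [this] at h4
    nlinarith
  · zify at *
    nlinarith [sq_nonneg ((n : ℤ) - 7)]
-- Numerical inequalities.
theorem sqrt_sq_add_one_le {x : ℝ} (hx : 2 ≤ x) : √(x ^ 2 + 1) ≤ x + 1 / (2 * x) := by
  refine Real.sqrt_le_iff.2 ⟨by positivity, ?_⟩
  have h1 : (x + 1 / (2 * x)) ^ 2 = x ^ 2 + 1 + (1 / (2 * x)) ^ 2 := by
    field_simp; ring
  nlinarith [sq_nonneg (1 / (2 * x))]

/-- The constant `41/50` is just below `√5 - √2`, which is what the worst case `a = b = 2` allows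
when the weight is `√(a² + 1)` minus a constant. -/
theorem sqrt_sq_add_sq_le_weight {a b : ℝ} (ha : 2 ≤ a) (hb : 2 ≤ b) :
    √(a ^ 2 + b ^ 2) ≤ (a + 1 / (2 * a) - 41 / 50) + (b + 1 / (2 * b) - 41 / 50) := by
  have h1 := sqrt_sq_add_one_le ha
  have h2 := sqrt_sq_add_one_le hb
  have e1 : (2.236 : ℝ) ≤ √(a ^ 2 + 1) := Real.le_sqrt_of_sq_le (by nlinarith)
  have e2 : (2.236 : ℝ) ≤ √(b ^ 2 + 1) := Real.le_sqrt_of_sq_le (by nlinarith)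
  have s1 := Real.sq_sqrt (show (0:ℝ) ≤ a ^ 2 + 1 by positivity)
  have s2 := Real.sq_sqrt (show (0:ℝ) ≤ b ^ 2 + 1 by positivity)
  suffices h : √(a ^ 2 + b ^ 2) ≤ √(a ^ 2 + 1) + √(b ^ 2 + 1) - 41 / 25 by linarith
  refine Real.sqrt_le_iff.2 ⟨by linarith, ?_⟩
  nlinarith [mul_nonneg (sub_nonneg.2 e1) (sub_nonneg.2 e2)]

/-- This and the next two comparisons order the values of the candidate graphs, with `m = n - 2`. -/
theorem bound_three_lt_bound_two (m : ℝ) :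
    (m - 2) * √(m ^ 2 + 1) + 2 * √(m ^ 2 + 4) + 2 * √8 <
    √10 + √13 + (m - 2) * √(m ^ 2 + 1) + √(m ^ 2 + 4) + √(m ^ 2 + 9) := by
  have h1 : √(m ^ 2 + 4) ≤ √(m ^ 2 + 9) := Real.sqrt_le_sqrt (by linarith)
  have h2 : √8 < √10 := Real.sqrt_lt_sqrt (by norm_num) (by norm_num)
  have h3 : √8 < √13 := Real.sqrt_lt_sqrt (by norm_num) (by norm_num)
  linarith

theorem bound_two_lt_bound_one (m : ℝ) (hm : 3 ≤ m) :
    √10 + √13 + (m - 2) * √(m ^ 2 + 1) + √(m ^ 2 + 4) + √(m ^ 2 + 9) <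
    √8 + (m - 1) * √((m + 1) ^ 2 + 1) + 2 * √((m + 1) ^ 2 + 4) := by
  have h1 : √(m ^ 2 + 9) ≤ √((m + 1) ^ 2 + 4) := Real.sqrt_le_sqrt (by nlinarith)
  have h2 : √(m ^ 2 + 4) ≤ √((m + 1) ^ 2 + 4) := Real.sqrt_le_sqrt (by nlinarith)
  have h3 : √(m ^ 2 + 1) ≤ √((m + 1) ^ 2 + 1) := Real.sqrt_le_sqrt (by nlinarith)
  have h4 : 4 ≤ √((m + 1) ^ 2 + 1) := Real.le_sqrt_of_sq_le (by nlinarith)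
  have h5 : (2.828 : ℝ) ≤ √8 := Real.le_sqrt_of_sq_le (by norm_num)
  have h6 : √10 ≤ (3.163 : ℝ) := Real.sqrt_le_iff.2 ⟨by norm_num, by norm_num⟩
  have h7 : √13 ≤ (3.606 : ℝ) := Real.sqrt_le_iff.2 ⟨by norm_num, by norm_num⟩
  -- After termwise comparison there remains `√10 + √13` against `√8` and one spare `√((m + 1)² + 1)
  -- ≥ 4`.
  nlinarith [mul_le_mul_of_nonneg_left h3 (show 0 ≤ m - 2 by linarith)]

/-- It comes down to `√(m² + 4) - √(m² + 1) ≤ 1/2 < √8 - √5`. -/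
theorem tail_lt_bound_three (m : ℝ) (hm : 3 ≤ m) :
    (m - 3) * √(m ^ 2 + 1) + 3 * √(m ^ 2 + 4) + √8 + √5 <
    (m - 2) * √(m ^ 2 + 1) + 2 * √(m ^ 2 + 4) + 2 * √8 := by
  have h1 : 3 ≤ √(m ^ 2 + 1) := Real.le_sqrt_of_sq_le (by nlinarith)
  have h2 : √(m ^ 2 + 4) ≤ √(m ^ 2 + 1) + 1 / 2 := by
    refine Real.sqrt_le_iff.2 ⟨by positivity, ?_⟩
    nlinarith [Real.sq_sqrt (show (0:ℝ) ≤ m ^ 2 + 1 by positivity)]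
  have h5 : (2.828 : ℝ) ≤ √8 := Real.le_sqrt_of_sq_le (by norm_num)
  have h6 : √5 ≤ (2.24 : ℝ) := Real.sqrt_le_iff.2 ⟨by norm_num, by norm_num⟩
  linarith
-- Graphs with all degrees at most `n - 3`.
theorem sum_add_card_filter_eq {V : Type*} [Fintype V] (G : SimpleGraph V) [DecidableRel G.Adj]
    (n : ℕ) (hV : Fintype.card V = n)
    (hsum : ∑ v, G.degree v = 2 * n) (l m k : ℝ) :
    ∑ v, (l * (G.degree v : ℝ) + m + (if G.degree v = 1 then k else 0)) =
      2 * l * n + m * n + k * (Finset.univ.filter fun v => G.degree v = 1).card := by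
  have h : (∑ v, (G.degree v : ℝ)) = 2 * n := by exact_mod_cast hsum
  rw [Finset.sum_add_distrib, Finset.sum_add_distrib, ← Finset.mul_sum, h, ← Finset.sum_filter]
  simp [hV]
  ring

section SmallDegree

variable {V : Type*} [Fintype V] [DecidableEq V] (G : SimpleGraph V) [DecidableRel G.Adj]

theorem card_degree_one_add_three_le (n : ℕ) (hn : 0 < n) (hV : Fintype.card V = n)
    (hsum : ∑ v, G.degree v = 2 * n) :
    (Finset.univ.filter fun v => G.degree v = 1).card + 3 ≤ n := by
  have h := three_le_card_two_le_degree G (by rw [hV, hsum]) (by omega)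
  have := Finset.card_filter_add_card_filter_not (s := (Finset.univ : Finset V))
    (fun v => G.degree v = 1)
  rw [Finset.card_univ, hV] at this
  simp only [ne_eq] at h
  omega

theorem sombor_le_of_degree_le_two (n : ℕ)
    (hsum : ∑ v, G.degree v = 2 * n) (hle : ∀ v, G.degree v ≤ 2) :
    sombor G ≤ n * √8 := by
  have h8 : √8 = 2 * √2 := by
    rw [show (8 : ℝ) = 2 ^ 2 * 2 by norm_num, Real.sqrt_mul (by positivity),
      Real.sqrt_sq (by norm_num)]
  have h := sombor_le_sum_degree_mul G (fun _ => √2) (fun u v _ => by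
    have hu : (G.degree u : ℝ) ≤ 2 := by exact_mod_cast hle u
    have hv : (G.degree v : ℝ) ≤ 2 := by exact_mod_cast hle v
    rw [← two_mul, ← h8]
    refine Real.sqrt_le_sqrt ?_
    nlinarith [Nat.cast_nonneg (α := ℝ) (G.degree u), Nat.cast_nonneg (α := ℝ) (G.degree v)])
  have hs : (∑ v, (G.degree v : ℝ)) = 2 * n := by exact_mod_cast hsum
  rw [← Finset.sum_mul, hs] at h
  rw [h8]
  linarith

/-- The weights satisfy the edge inequality for each pair of degrees up to 3; `d F(d)` is then
bounded by its chord through `d = 1` and `d = 3`, whose sum over the vertices is fixed by the degree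
sum. -/
theorem sombor_le_of_card_eq_six (hV : Fintype.card V = 6) (hpos : ∀ v, 1 ≤ G.degree v)
    (hsum : ∑ v, G.degree v = 2 * 6) (hle : ∀ v, G.degree v ≤ 3) : sombor G ≤ 22.5 := by
  have h := sombor_le_sum_degree_mul G
    (fun d => if d = 1 then 1.042 else if d = 2 then 1.485 else 2.122) (fun u v _ => by
    have hu := hpos u; have hv := hpos v; have hu' := hle u; have hv' := hle v
    generalize G.degree u = a at *
    generalize G.degree v = b at *
    interval_cases a <;> interval_cases b <;>
      exact Real.sqrt_le_iff.2 ⟨by norm_num, by norm_num⟩)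
  have h2 := Finset.sum_le_sum (s := (Finset.univ : Finset V)) (f := fun v => (G.degree v : ℝ) *
      (if G.degree v = 1 then 1.042 else if G.degree v = 2 then 1.485 else 2.122))
    (g := fun v => 2.662 * (G.degree v : ℝ) + (-1.62) + (if G.degree v = 1 then 0 else 0))
    (fun v _ => by
      have hv := hpos v; have hv' := hle v
      generalize G.degree v = b at *
      interval_cases b <;> norm_num)
  rw [sum_add_card_filter_eq G 6 hV hsum] at h2
  norm_num at h h2 ⊢
  linarith

theorem sombor_le_of_card_eq_seven (hV : Fintype.card V = 7) (hpos : ∀ v, 1 ≤ G.degree v)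
    (hsum : ∑ v, G.degree v = 2 * 7) (hle : ∀ v, G.degree v ≤ 4) : sombor G ≤ 31.3 := by
  have h := sombor_le_sum_degree_mul G
    (fun d => if d = 1 then 1.295 else if d = 2 then 1.645 else if d = 3 then 2.173 else 2.829)
    (fun u v _ => by
    have hu := hpos u; have hv := hpos v; have hu' := hle u; have hv' := hle v
    generalize G.degree u = a at *
    generalize G.degree v = b at *
    interval_cases a <;> interval_cases b <;>
      exact Real.sqrt_le_iff.2 ⟨by norm_num, by norm_num⟩)
  have h2 := Finset.sum_le_sum (s := (Finset.univ : Finset V)) (f := fun v => (G.degree v : ℝ) *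
      (if G.degree v = 1 then 1.295 else if G.degree v = 2 then 1.645
        else if G.degree v = 3 then 2.173 else 2.829))
    -- The line passes through the value at `d = 2` and just above that at `d = 4`; the leaf term
    -- restores equality at `d = 1`, and there are at most four leaves.
    (g := fun v => 4.014 * (G.degree v : ℝ) + (-4.738) + (if G.degree v = 1 then 2.019 else 0))
    (fun v _ => by
      have hv := hpos v; have hv' := hle v
      generalize G.degree v = b at *
      interval_cases b <;> norm_num)
  rw [sum_add_card_filter_eq G 7 hV hsum] at h2
  have h3 : ((Finset.univ.filter fun v => G.degree v = 1).card : ℝ) ≤ 4 := by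
    have := card_degree_one_add_three_le G 7 (by norm_num) hV hsum
    exact_mod_cast (by omega : (Finset.univ.filter fun v => G.degree v = 1).card ≤ 4)
  norm_num at h h2 ⊢
  linarith

theorem sombor_le_of_seven_le (n : ℕ) (hn : 7 ≤ n) (hV : Fintype.card V = n)
    (hpos : ∀ v, 1 ≤ G.degree v) (hsum : ∑ v, G.degree v = 2 * n)
    (hle : ∀ v, G.degree v + 3 ≤ n) : sombor G ≤ (n : ℝ) ^ 2 - 6 * n + 25.58 := by
  have h := sombor_le_sum_degree_mul G
    -- The shift `41/50` cancels on an edge at a leaf, leaving `d + 1/(2d) ≥ √(d² + 1)`.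
    (fun d => if d = 1 then 41 / 50 else (d : ℝ) + 1 / (2 * d) - 41 / 50)
    (fun u v _ => by
    have hu := hpos u; have hv := hpos v
    generalize G.degree u = a at *
    generalize G.degree v = b at *
    have cast_le : ∀ x : ℕ, 1 ≤ x → x ≠ 1 → (2 : ℝ) ≤ x := fun x h1 h2 => by
      exact_mod_cast (by omega : 2 ≤ x)
    by_cases ha : a = 1 <;> by_cases hb : b = 1
    · simp only [ha, hb, if_true]
      exact Real.sqrt_le_iff.2 ⟨by norm_num, by norm_num⟩
    · simp only [ha, hb, if_true, if_false]
      have := sqrt_sq_add_one_le (cast_le b hv hb)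
      rw [add_comm] at this
      norm_num at this ⊢
      linarith
    · simp only [ha, hb, if_true, if_false]
      have := sqrt_sq_add_one_le (cast_le a hu ha)
      norm_num at this ⊢
      linarith
    · simp only [ha, hb, if_false]
      exact sqrt_sq_add_sq_le_weight (cast_le a hu ha) (cast_le b hv hb))
  have hexc := sum_sq_le_of_le_sub_four (fun v => G.degree v - 1) n hn
    (by
      have : ∑ v, (G.degree v - 1) + ∑ _v : V, 1 = ∑ v, G.degree v := by
        rw [← Finset.sum_add_distrib]
        exact Finset.sum_congr rfl fun v _ => Nat.sub_add_cancel (hpos v)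
      rw [hsum] at this
      simp [hV] at this
      omega)
    (fun v => by have := hle v; have := hpos v; omega)
    (by
      have h3 := three_le_card_two_le_degree G (by rw [hV, hsum]) (by omega)
      refine h3.trans (Finset.card_le_card fun v => ?_)
      have := hpos v
      simp only [Finset.mem_filter, Finset.mem_univ, true_and]
      omega)
  have h2 : ∑ v, (G.degree v : ℝ) *
      (if G.degree v = 1 then 41 / 50 else (G.degree v : ℝ) + 1 / (2 * G.degree v) - 41 / 50) =
      ∑ v, (((G.degree v - 1) ^ 2 : ℕ) : ℝ) +
        ∑ v, (1.18 * (G.degree v : ℝ) + (-0.5) + (if G.degree v = 1 then 0.14 else 0)) := by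
    rw [← Finset.sum_add_distrib]
    refine Finset.sum_congr rfl fun v _ => ?_
    have hv := hpos v
    generalize G.degree v = b at *
    have hb0 : (b : ℝ) ≠ 0 := by positivity
    push_cast [Nat.cast_sub hv]
    split_ifs with hb
    · subst hb; norm_num
    · field_simp; ring
  rw [sum_add_card_filter_eq G n hV hsum, ← Nat.cast_sum] at h2
  have h3 : ((Finset.univ.filter fun v => G.degree v = 1).card : ℝ) + 3 ≤ n := by
    exact_mod_cast card_degree_one_add_three_le G n (by omega) hV hsum
  have h4 : ((∑ v, (G.degree v - 1) ^ 2 : ℕ) : ℝ) + 8 * n ≤ (n : ℝ) ^ 2 + 26 := by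
    exact_mod_cast hexc
  rw [h2] at h
  linarith

/-- The target exceeds `(n - 2)² + 2√8`, which beats `n² - 6n + 25.58` only from `n = 8` on, and
there narrowly. -/
theorem sombor_lt_of_degree_add_three_le (n : ℕ) (hn : 5 ≤ n) (hV : Fintype.card V = n)
    (hpos : ∀ v, 1 ≤ G.degree v) (hsum : ∑ v, G.degree v = 2 * n)
    (hle : ∀ v, G.degree v + 3 ≤ n) :
    sombor G < ((n : ℝ) - 4) * √(((n : ℝ) - 2) ^ 2 + 1) + 2 * √(((n : ℝ) - 2) ^ 2 + 4)
          + 2 * √8 := by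
  have h8 : (2.828 : ℝ) ≤ √8 := Real.le_sqrt_of_sq_le (by norm_num)
  rcases (by omega : n = 5 ∨ n = 6 ∨ n = 7 ∨ 8 ≤ n) with rfl | rfl | rfl | h
  · have h := sombor_le_of_degree_le_two G 5 hsum (fun v => by have := hle v; omega)
    have h1 : (3.162 : ℝ) ≤ √10 := Real.le_sqrt_of_sq_le (by norm_num)
    have h2 : (3.605 : ℝ) ≤ √13 := Real.le_sqrt_of_sq_le (by norm_num)
    have h3 : √8 ≤ (2.829 : ℝ) := Real.sqrt_le_iff.2 ⟨by norm_num, by norm_num⟩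
    norm_num at *
    linarith
  · have h := sombor_le_of_card_eq_six G hV hpos hsum (fun v => by have := hle v; omega)
    have h1 : (4.123 : ℝ) ≤ √17 := Real.le_sqrt_of_sq_le (by norm_num)
    have h2 : (4.472 : ℝ) ≤ √20 := Real.le_sqrt_of_sq_le (by norm_num)
    norm_num at *
    linarith
  · have h := sombor_le_of_card_eq_seven G hV hpos hsum (fun v => by have := hle v; omega)
    have h1 : (5.099 : ℝ) ≤ √26 := Real.le_sqrt_of_sq_le (by norm_num)
    have h2 : (5.385 : ℝ) ≤ √29 := Real.le_sqrt_of_sq_le (by norm_num)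
    norm_num at *
    linarith
  · have hS := sombor_le_of_seven_le G n (by omega) hV hpos hsum hle
    have hnR : (8 : ℝ) ≤ n := by exact_mod_cast h
    have h1 : (n : ℝ) - 2 ≤ √(((n : ℝ) - 2) ^ 2 + 1) := Real.le_sqrt_of_sq_le (by linarith)
    have h2 : (n : ℝ) - 2 ≤ √(((n : ℝ) - 2) ^ 2 + 4) := Real.le_sqrt_of_sq_le (by linarith)
    nlinarith [mul_le_mul_of_nonneg_left h1 (show (0 : ℝ) ≤ n - 4 by linarith)]

end SmallDegree
-- Structure of graphs with a vertex of degree `n - 1` or `n - 2`.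
/-- `G` is the star with centre `c` spanning all vertices, together with the edge `pq`. -/
def IsStarWith {V : Type*} (G : SimpleGraph V) (c p q : V) : Prop :=
  ∀ u v, G.Adj u v ↔ (u = c ∧ v ≠ c) ∨ (v = c ∧ u ≠ c) ∨ s(u, v) = s(p, q)

/-- `G` is the star with centre `c` spanning all vertices but `w`, together with the edges `pq`
and `rs`. -/
def IsStarOffWith {V : Type*} (G : SimpleGraph V) (c w p q r s : V) : Prop :=
  ∀ u v, G.Adj u v ↔ (u = c ∧ v ≠ c ∧ v ≠ w) ∨ (v = c ∧ u ≠ c ∧ u ≠ w) ∨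
    s(u, v) = s(p, q) ∨ s(u, v) = s(r, s)

/-- Adjacency in a near-star depends only on a few named vertices, so any bijection matching these
is an isomorphism; this supplies one. -/
theorem exists_equiv_apply_eq {V W ι : Type*} [Fintype V] [Fintype W]
    (a : ι → V) (b : ι → W) (ha : Function.Injective a) (hb : Function.Injective b)
    (h : Fintype.card V = Fintype.card W) : ∃ e : V ≃ W, ∀ i, e (a i) = b i := by
  classical
  let e₀ : V ≃ W := Fintype.equivOfCardEq h
  have hb' : Function.Injective (e₀.symm ∘ b) := e₀.symm.injective.comp hb
  let f : {v // v ∈ Set.range a} ≃ {v // v ∈ Set.range (e₀.symm ∘ b)} :=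
    (Equiv.ofInjective a ha).symm.trans (Equiv.ofInjective _ hb')
  refine ⟨f.extendSubtype.trans e₀, fun i => ?_⟩
  have hi : (f ⟨a i, Set.mem_range_self i⟩ : V) = e₀.symm (b i) := by
    have : (Equiv.ofInjective a ha).symm ⟨a i, Set.mem_range_self i⟩ = i := by
      rw [Equiv.symm_apply_eq]; rfl
    simp only [f, Equiv.trans_apply, this]
    rfl
  rw [Equiv.trans_apply, Equiv.extendSubtype_apply_of_mem f _ (Set.mem_range_self i), hi,
    Equiv.apply_symm_apply]

theorem card_filter_notMem_add_degree {V : Type*} [Fintype V] [DecidableEq V] (G : SimpleGraph V)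
    [DecidableRel G.Adj] (c : V) :
    (G.edgeFinset.filter fun e => c ∉ e).card + G.degree c = G.edgeFinset.card := by
  rw [← G.card_incidenceFinset_eq_degree, G.incidenceFinset_eq_filter, add_comm]
  exact Finset.card_filter_add_card_filter_not _

theorem exists_isStarWith {V : Type*} [Fintype V] [DecidableEq V] (G : SimpleGraph V)
    [DecidableRel G.Adj] (c : V) (hE : G.edgeFinset.card = Fintype.card V)
    (hc : G.degree c + 1 = Fintype.card V) :
    ∃ p q, p ≠ c ∧ q ≠ c ∧ p ≠ q ∧ IsStarWith G c p q := by
  have hT := card_filter_notMem_add_degree G c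
  have hN : ∀ v, v ≠ c → G.Adj c v := by
    have h1 : G.neighborFinset c = Finset.univ.erase c := by
      refine Finset.eq_of_subset_of_card_le (fun v hv => ?_) ?_
      · rw [SimpleGraph.mem_neighborFinset] at hv
        simp [hv.ne']
      · rw [Finset.card_erase_of_mem (Finset.mem_univ c), Finset.card_univ,
          SimpleGraph.card_neighborFinset_eq_degree]
        omega
    intro v hv
    rw [← SimpleGraph.mem_neighborFinset, h1]
    simp [hv]
  obtain ⟨e, he⟩ := Finset.card_eq_one.1
    (by omega : (G.edgeFinset.filter fun e => c ∉ e).card = 1)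
  induction e using Sym2.ind with
  | _ p q =>
    have hmem : ∀ u v, (G.Adj u v ∧ u ≠ c ∧ v ≠ c) ↔ s(u, v) = s(p, q) := by
      intro u v
      rw [← Finset.mem_singleton, ← he]
      simp [eq_comm]
    obtain ⟨hpq, hp, hq⟩ := (hmem p q).2 rfl
    refine ⟨p, q, hp, hq, hpq.ne, fun u v => ?_⟩
    rw [← hmem]
    by_cases hu : u = c
    · subst hu
      by_cases hv : v = u
      · simp [hv]
      · simp [hv, hN v hv]
    · by_cases hv : v = c
      · subst hv
        simp [hu, (hN u hu).symm]
      · simp [hu, hv]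

theorem exists_isStarOffWith {V : Type*} [Fintype V] [DecidableEq V] (G : SimpleGraph V)
    [DecidableRel G.Adj] (c : V) (hpos : ∀ v, 1 ≤ G.degree v)
    (hE : G.edgeFinset.card = Fintype.card V) (hc : G.degree c + 2 = Fintype.card V) :
    ∃ w t p q, w ≠ c ∧ t ≠ c ∧ t ≠ w ∧ p ≠ c ∧ q ≠ c ∧ p ≠ q ∧ s(t, w) ≠ s(p, q) ∧
      IsStarOffWith G c w t w p q := by
  have hT := card_filter_notMem_add_degree G c
  have hcc : ((G.neighborFinset c)ᶜ).card = 2 := by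
    rw [Finset.card_compl, SimpleGraph.card_neighborFinset_eq_degree]
    omega
  obtain ⟨w, hw, hcw⟩ := Finset.exists_mem_ne (by omega : 1 < ((G.neighborFinset c)ᶜ).card) c
  have h1 : {c, w} = (G.neighborFinset c)ᶜ := by
    refine Finset.eq_of_subset_of_card_le (fun v hv => ?_) ?_
    · simp only [Finset.mem_insert, Finset.mem_singleton] at hv
      rcases hv with rfl | rfl
      · simp
      · exact hw
    · rw [hcc, Finset.card_pair hcw.symm]
  have hN : ∀ v, G.Adj c v ↔ v ≠ c ∧ v ≠ w := by
    intro v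
    have : v ∈ ({c, w} : Finset V) ↔ v ∈ (G.neighborFinset c)ᶜ := by rw [h1]
    simp only [Finset.mem_insert, Finset.mem_singleton, Finset.mem_compl,
      SimpleGraph.mem_neighborFinset] at this
    tauto
  -- As `w` is neither isolated nor adjacent to `c`, one of the two edges avoiding `c` ends at `w`.
  obtain ⟨t, ht⟩ := (G.degree_pos_iff_exists_adj w).1 (hpos w)
  have htc : t ≠ c := by
    rintro rfl
    exact ((hN w).1 ht.symm).2 rfl
  have htm : s(t, w) ∈ G.edgeFinset.filter fun e => c ∉ e := by
    simp [ht.symm, htc.symm, hcw.symm]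
  have h2 : ((G.edgeFinset.filter fun e => c ∉ e).erase s(t, w)).card = 1 := by
    rw [Finset.card_erase_of_mem htm]
    omega
  obtain ⟨e, he⟩ := Finset.card_eq_one.1 h2
  induction e using Sym2.ind with
  | _ p q =>
    have hpq : s(p, q) ∈ (G.edgeFinset.filter fun e => c ∉ e).erase s(t, w) := by simp [he]
    have hmem : ∀ u v, (G.Adj u v ∧ u ≠ c ∧ v ≠ c) ↔ s(u, v) = s(t, w) ∨ s(u, v) = s(p, q) := by
      intro u v
      have h4 : s(u, v) ∈ (G.edgeFinset.filter fun e => c ∉ e).erase s(t, w) ↔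
          s(u, v) = s(p, q) := by rw [he, Finset.mem_singleton]
      rw [Finset.mem_erase] at h4
      have : s(u, v) = s(t, w) → s(u, v) ∈ G.edgeFinset.filter fun e => c ∉ e := fun h => h ▸ htm
      have h3 : s(u, v) ∈ (G.edgeFinset.filter fun e => c ∉ e) ↔ (G.Adj u v ∧ u ≠ c ∧ v ≠ c) := by
        simp [eq_comm]
      tauto
    obtain ⟨hpq', hp, hq⟩ := (hmem p q).2 (Or.inr rfl)
    refine ⟨w, t, p, q, hcw, htc, ht.ne', hp, hq, hpq'.ne, (Finset.ne_of_mem_erase hpq).symm,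
      fun u v => ?_⟩
    rw [← hmem]
    by_cases hu : u = c
    · subst hu
      by_cases hv : v = u
      · simp [hv]
      · simp [hv, hN v]
    · by_cases hv : v = c
      · subst hv
        simp [hu, G.adj_comm u v, hN u]
      · simp [hu, hv]

theorem IsStarWith.nonempty_iso {V W : Type*} {G : SimpleGraph V} {H : SimpleGraph W} {c p q : V}
    {e : V ≃ W} (hG : IsStarWith G c p q) (hH : IsStarWith H (e c) (e p) (e q)) :
    Nonempty (G ≃g H) :=
  ⟨⟨e, by intro u v; rw [hG, hH]; simp⟩⟩

theorem IsStarOffWith.nonempty_iso {V W : Type*} {G : SimpleGraph V} {H : SimpleGraph W}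
    {c w p q r s : V} {e : V ≃ W} (hG : IsStarOffWith G c w p q r s)
    (hH : IsStarOffWith H (e c) (e w) (e p) (e q) (e r) (e s)) :
    Nonempty (G ≃g H) :=
  ⟨⟨e, by intro u v; rw [hG, hH]; simp⟩⟩

theorem graphQ_isStarWith (n : ℕ) (hn : 3 ≤ n) :
    IsStarWith (graphQ n 2) ⟨0, by omega⟩ ⟨1, by omega⟩ ⟨n - 1, by omega⟩ := by
  intro u v
  simp only [graphQ, SimpleGraph.fromRel_adj, Sym2.eq_iff, Fin.ext_iff, ne_eq]
  omega

theorem graphQPrimeTwo_isStarOffWith (n : ℕ) (hn : 5 ≤ n) :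
    IsStarOffWith (graphQPrimeTwo n) ⟨0, by omega⟩ ⟨n - 1, by omega⟩ ⟨1, by omega⟩
      ⟨n - 1, by omega⟩ ⟨1, by omega⟩ ⟨n - 2, by omega⟩ := by
  intro u v
  simp only [graphQPrimeTwo, SimpleGraph.fromRel_adj, Sym2.eq_iff, Fin.ext_iff, ne_eq]
  omega

theorem graphQStar_isStarOffWith (n : ℕ) (hn : 5 ≤ n) :
    IsStarOffWith (graphQStar n 2) ⟨0, by omega⟩ ⟨n - 1, by omega⟩ ⟨1, by omega⟩
      ⟨n - 1, by omega⟩ ⟨2, by omega⟩ ⟨n - 1, by omega⟩ := by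
  intro u v
  simp only [graphQStar, SimpleGraph.fromRel_adj, Sym2.eq_iff, Fin.ext_iff, ne_eq]
  omega
-- Sombor indices of the near-stars.
theorem sum_eq_sum_add_card_sub_mul {V : Type*} [DecidableEq V] (N B : Finset V) (hB : B ⊆ N)
    (h : V → ℝ) (k : ℝ) (hk : ∀ v ∈ N, v ∉ B → h v = k) :
    ∑ v ∈ N, h v = ∑ v ∈ B, h v + ((N.card : ℝ) - B.card) * k := by
  rw [← Finset.sum_sdiff hB, add_comm, Finset.sum_congr rfl (g := fun _ => k)
    (fun v hv => hk v (Finset.mem_sdiff.1 hv).1 (Finset.mem_sdiff.1 hv).2), Finset.sum_const,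
    Finset.card_sdiff_of_subset hB, nsmul_eq_mul, Nat.cast_sub (Finset.card_le_card hB)]

theorem IsStarOffWith.degree_eq_one {V : Type*} [Fintype V] {G : SimpleGraph V}
    [DecidableRel G.Adj] {c w p q r s v : V} (hG : IsStarOffWith G c w p q r s)
    (hc : v ≠ c) (hw : v ≠ w) (hp : v ≠ p) (hq : v ≠ q) (hr : v ≠ r) (hs : v ≠ s) :
    G.degree v = 1 := by
  have : G.neighborFinset v = {c} := by
    ext u; simp only [SimpleGraph.mem_neighborFinset, hG v u, Sym2.eq_iff]; simp; grind
  rw [← G.card_neighborFinset_eq_degree, this, Finset.card_singleton]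

section Values

variable {V : Type*} [Fintype V] [DecidableEq V] {G : SimpleGraph V} [DecidableRel G.Adj]

theorem IsStarWith.sombor_eq {c p q : V} (hG : IsStarWith G c p q) (hp : p ≠ c) (hq : q ≠ c)
    (hpq : p ≠ q) (n : ℕ) (hV : Fintype.card V = n) :
    sombor G = √8 + ((n : ℝ) - 3) * √(((n : ℝ) - 1) ^ 2 + 1) + 2 * √(((n : ℝ) - 1) ^ 2 + 4) := by
  have hNc : G.neighborFinset c = Finset.univ.erase c := by
    ext v; simp only [SimpleGraph.mem_neighborFinset, hG c v, Sym2.eq_iff]; simp; grind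
  have hNp : G.neighborFinset p = {c, q} := by
    ext v; simp only [SimpleGraph.mem_neighborFinset, hG p v, Sym2.eq_iff]; simp; grind
  have hNq : G.neighborFinset q = {c, p} := by
    ext v; simp only [SimpleGraph.mem_neighborFinset, hG q v, Sym2.eq_iff]; simp; grind
  have hNv : ∀ v, v ≠ c → v ≠ p → v ≠ q → G.degree v = 1 := by
    intro v h1 h2 h3
    have : G.neighborFinset v = {c} := by
      ext u; simp only [SimpleGraph.mem_neighborFinset, hG v u, Sym2.eq_iff]; simp; grind
    rw [← G.card_neighborFinset_eq_degree, this, Finset.card_singleton]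
  have hcard : ((G.neighborFinset c).card : ℝ) = n - 1 := by
    have : 0 < Fintype.card V := Fintype.card_pos_iff.2 ⟨c⟩
    rw [hNc, Finset.card_erase_of_mem (Finset.mem_univ c), Finset.card_univ,
      Nat.cast_sub (by omega), hV, Nat.cast_one]
  have hdc : (G.degree c : ℝ) = n - 1 := by rw [← G.card_neighborFinset_eq_degree, hcard]
  have hdp : G.degree p = 2 := by
    rw [← G.card_neighborFinset_eq_degree, hNp, Finset.card_pair hq.symm]
  have hdq : G.degree q = 2 := by
    rw [← G.card_neighborFinset_eq_degree, hNq, Finset.card_pair hp.symm]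
  have hT : (G.edgeFinset.filter fun e => c ∉ e) = {s(p, q)} := by
    ext e
    induction e using Sym2.ind with
    | _ u v =>
      simp only [Finset.mem_filter, SimpleGraph.mem_edgeFinset, SimpleGraph.mem_edgeSet, hG u v,
        Sym2.mem_iff, Finset.mem_singleton, Sym2.eq_iff]
      grind
  rw [sombor_eq_sum_neighbor_add G c, hT, Finset.sum_singleton,
    sum_eq_sum_add_card_sub_mul _ {p, q} (by rw [hNc]; intro v; simp; grind) _
      (√(((n : ℝ) - 1) ^ 2 + 1)) (fun v hv hv' => by
        simp only [hNc, Finset.mem_erase, Finset.mem_insert, Finset.mem_singleton, not_or] at hv hv'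
        rw [hNv v hv.1 hv'.1 hv'.2, hdc]; norm_num),
    Finset.sum_pair hpq, Finset.card_pair hpq, hcard, hdc]
  simp only [Sym2.lift_mk, hdp, hdq]
  norm_num
  ring

theorem IsStarOffWith.neighborFinset_centre {c w p q r s : V} (hG : IsStarOffWith G c w p q r s)
    (hp : p ≠ c) (hq : q ≠ c) (hr : r ≠ c) (hs : s ≠ c) :
    G.neighborFinset c = (Finset.univ.erase c).erase w := by
  ext v; simp only [SimpleGraph.mem_neighborFinset, hG c v, Sym2.eq_iff]; simp; grind

theorem IsStarOffWith.degree_centre {c w p q r s : V} (hG : IsStarOffWith G c w p q r s)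
    (hp : p ≠ c) (hq : q ≠ c) (hr : r ≠ c) (hs : s ≠ c) (hw : w ≠ c) :
    (G.degree c : ℝ) = Fintype.card V - 2 := by
  have : 2 ≤ Fintype.card V := by
    rw [← Finset.card_pair hw, ← Finset.card_univ]
    exact Finset.card_le_card (Finset.subset_univ _)
  rw [← G.card_neighborFinset_eq_degree, hG.neighborFinset_centre hp hq hr hs,
    Finset.card_erase_of_mem (by simp [hw]), Finset.card_erase_of_mem (Finset.mem_univ c),
    Finset.card_univ, Nat.sub_sub, Nat.cast_sub this, Nat.cast_ofNat]

theorem IsStarOffWith.filter_eq {c w p q r s : V} (hG : IsStarOffWith G c w p q r s)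
    (hp : p ≠ c) (hq : q ≠ c) (hr : r ≠ c) (hs : s ≠ c) :
    (G.edgeFinset.filter fun e => c ∉ e) = {s(p, q), s(r, s)} := by
  ext e
  induction e using Sym2.ind with
  | _ u v =>
    simp only [Finset.mem_filter, SimpleGraph.mem_edgeFinset, SimpleGraph.mem_edgeSet, hG u v,
      Sym2.mem_iff, Finset.mem_insert, Finset.mem_singleton, Sym2.eq_iff]
    grind

/-- The contributions to the Sombor index of a star with two further edges: `B` contains all
neighbours of the centre whose degree is not one. -/
theorem IsStarOffWith.sombor_eq_sum {c w p q r s : V} (hG : IsStarOffWith G c w p q r s)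
    (hp : p ≠ c) (hq : q ≠ c) (hr : r ≠ c) (hs : s ≠ c) (hw : w ≠ c) (hne : s(p, q) ≠ s(r, s))
    (n : ℕ) (hV : Fintype.card V = n) (B : Finset V) (hcB : c ∉ B) (hwB : w ∉ B)
    (hB : ∀ v, v ≠ w → v = p ∨ v = q ∨ v = r ∨ v = s → v ∈ B) :
    sombor G = ∑ v ∈ B, √(((n : ℝ) - 2) ^ 2 + (G.degree v : ℝ) ^ 2) +
      ((n : ℝ) - 2 - B.card) * √(((n : ℝ) - 2) ^ 2 + 1) +
      √((G.degree p : ℝ) ^ 2 + (G.degree q : ℝ) ^ 2) +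
      √((G.degree r : ℝ) ^ 2 + (G.degree s : ℝ) ^ 2) := by
  have hd := hG.degree_centre hp hq hr hs hw
  have hN := hG.neighborFinset_centre hp hq hr hs
  have hcard : ((G.neighborFinset c).card : ℝ) = n - 2 := by
    rw [G.card_neighborFinset_eq_degree, hd, hV]
  rw [sombor_eq_sum_neighbor_add G c, hG.filter_eq hp hq hr hs, Finset.sum_pair hne,
    sum_eq_sum_add_card_sub_mul _ B (by
        intro v hv
        rw [hN, Finset.mem_erase, Finset.mem_erase]
        exact ⟨fun h => hwB (h ▸ hv), fun h => hcB (h ▸ hv), Finset.mem_univ v⟩) _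
      (√(((n : ℝ) - 2) ^ 2 + 1)) (fun v hv hv' => by
        rw [hN, Finset.mem_erase, Finset.mem_erase] at hv
        have := hB v hv.1
        rw [hG.degree_eq_one hv.2.1 hv.1 (by tauto) (by tauto) (by tauto) (by tauto), hd, hV]
        norm_num),
    hcard, hd, hV, Sym2.lift_mk, Sym2.lift_mk]
  ring

/-- The pendant vertex `w` hangs at a triangle vertex `x` other than the centre. -/
theorem IsStarOffWith.sombor_eq_of_common {c w x y : V} (hG : IsStarOffWith G c w x w x y)
    (hw : w ≠ c) (hx : x ≠ c) (hy : y ≠ c) (hxw : x ≠ w) (hyw : y ≠ w) (hxy : x ≠ y)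
    (n : ℕ) (hV : Fintype.card V = n) :
    sombor G = √10 + √13 + ((n : ℝ) - 4) * √(((n : ℝ) - 2) ^ 2 + 1)
          + √(((n : ℝ) - 2) ^ 2 + 4) + √(((n : ℝ) - 2) ^ 2 + 9) := by
  have hNx : G.neighborFinset x = {c, w, y} := by
    ext v; simp only [SimpleGraph.mem_neighborFinset, hG x v, Sym2.eq_iff]; simp; grind
  have hNy : G.neighborFinset y = {c, x} := by
    ext v; simp only [SimpleGraph.mem_neighborFinset, hG y v, Sym2.eq_iff]; simp; grind
  have hNw : G.neighborFinset w = {x} := by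
    ext v; simp only [SimpleGraph.mem_neighborFinset, hG w v, Sym2.eq_iff]; simp; grind
  have hdx : G.degree x = 3 := by
    rw [← G.card_neighborFinset_eq_degree, hNx]
    exact Finset.card_eq_three.2 ⟨c, w, y, hw.symm, hy.symm, hyw.symm, rfl⟩
  have hdy : G.degree y = 2 := by
    rw [← G.card_neighborFinset_eq_degree, hNy, Finset.card_pair hx.symm]
  have hdw : G.degree w = 1 := by
    rw [← G.card_neighborFinset_eq_degree, hNw, Finset.card_singleton]
  rw [hG.sombor_eq_sum hx hw hx hy hw (by simp [hyw.symm, hxy]) n hV {x, y}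
    (by simp [hx.symm, hy.symm]) (by simp [hxw.symm, hyw.symm]) (by simp; grind),
    Finset.sum_pair hxy, Finset.card_pair hxy, hdx, hdy, hdw]
  norm_num
  ring

/-- The vertex `w` is joined to two neighbours of the centre. -/
theorem IsStarOffWith.sombor_eq_of_quadrangle {c w x y : V} (hG : IsStarOffWith G c w x w y w)
    (hw : w ≠ c) (hx : x ≠ c) (hy : y ≠ c) (hxw : x ≠ w) (hyw : y ≠ w) (hxy : x ≠ y)
    (n : ℕ) (hV : Fintype.card V = n) :
    sombor G = ((n : ℝ) - 4) * √(((n : ℝ) - 2) ^ 2 + 1) + 2 * √(((n : ℝ) - 2) ^ 2 + 4)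
          + 2 * √8 := by
  have hNx : G.neighborFinset x = {c, w} := by
    ext v; simp only [SimpleGraph.mem_neighborFinset, hG x v, Sym2.eq_iff]; simp; grind
  have hNy : G.neighborFinset y = {c, w} := by
    ext v; simp only [SimpleGraph.mem_neighborFinset, hG y v, Sym2.eq_iff]; simp; grind
  have hNw : G.neighborFinset w = {x, y} := by
    ext v; simp only [SimpleGraph.mem_neighborFinset, hG w v, Sym2.eq_iff]; simp; grind
  have hdx : G.degree x = 2 := by
    rw [← G.card_neighborFinset_eq_degree, hNx, Finset.card_pair hw.symm]
  have hdy : G.degree y = 2 := by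
    rw [← G.card_neighborFinset_eq_degree, hNy, Finset.card_pair hw.symm]
  have hdw : G.degree w = 2 := by
    rw [← G.card_neighborFinset_eq_degree, hNw, Finset.card_pair hxy]
  rw [hG.sombor_eq_sum hx hw hy hw hw (by simp [hxy, hxw]) n hV {x, y}
    (by simp [hx.symm, hy.symm]) (by simp [hxw.symm, hyw.symm]) (by simp; grind),
    Finset.sum_pair hxy, Finset.card_pair hxy, hdx, hdy, hdw]
  norm_num
  ring

/-- The vertex `w` is the end of a pendant path of length two at the centre. -/
theorem IsStarOffWith.sombor_eq_of_tail {c w x y z : V} (hG : IsStarOffWith G c w x w y z)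
    (hw : w ≠ c) (hx : x ≠ c) (hy : y ≠ c) (hz : z ≠ c) (hxw : x ≠ w) (hyw : y ≠ w) (hzw : z ≠ w)
    (hxy : x ≠ y) (hxz : x ≠ z) (hyz : y ≠ z) (n : ℕ) (hV : Fintype.card V = n) :
    sombor G = ((n : ℝ) - 5) * √(((n : ℝ) - 2) ^ 2 + 1) + 3 * √(((n : ℝ) - 2) ^ 2 + 4)
          + √8 + √5 := by
  have hNx : G.neighborFinset x = {c, w} := by
    ext v; simp only [SimpleGraph.mem_neighborFinset, hG x v, Sym2.eq_iff]; simp; grind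
  have hNy : G.neighborFinset y = {c, z} := by
    ext v; simp only [SimpleGraph.mem_neighborFinset, hG y v, Sym2.eq_iff]; simp; grind
  have hNz : G.neighborFinset z = {c, y} := by
    ext v; simp only [SimpleGraph.mem_neighborFinset, hG z v, Sym2.eq_iff]; simp; grind
  have hNw : G.neighborFinset w = {x} := by
    ext v; simp only [SimpleGraph.mem_neighborFinset, hG w v, Sym2.eq_iff]; simp; grind
  have hdx : G.degree x = 2 := by
    rw [← G.card_neighborFinset_eq_degree, hNx, Finset.card_pair hw.symm]
  have hdy : G.degree y = 2 := by
    rw [← G.card_neighborFinset_eq_degree, hNy, Finset.card_pair hz.symm]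
  have hdz : G.degree z = 2 := by
    rw [← G.card_neighborFinset_eq_degree, hNz, Finset.card_pair hy.symm]
  have hdw : G.degree w = 1 := by
    rw [← G.card_neighborFinset_eq_degree, hNw, Finset.card_singleton]
  rw [hG.sombor_eq_sum hx hw hy hz hw (by simp [hxy, hxz]) n hV {x, y, z}
    (by simp [hx.symm, hy.symm, hz.symm]) (by simp [hxw.symm, hyw.symm, hzw.symm])
    (by simp; grind),
    Finset.sum_insert (by simp [hxy, hxz]), Finset.sum_pair hyz,
    Finset.card_eq_three.2 ⟨x, y, z, hxy, hxz, hyz, rfl⟩, hdx, hdy, hdz, hdw]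
  norm_num
  ring

end Values
-- Classification when some degree is `n - 2`.
theorem Sym2.exists_eq_mk_of_mem {V : Type*} {p q w : V} (h : w ∈ s(p, q)) :
    ∃ y, s(p, q) = s(y, w) := by
  obtain ⟨y, hy⟩ := h
  exact ⟨y, hy.trans Sym2.eq_swap⟩

section Classification

variable {V : Type*} [Fintype V] [DecidableEq V] (G : SimpleGraph V) [DecidableRel G.Adj]

theorem IsStarOffWith.congr {V : Type*} {G : SimpleGraph V} {c w p q r s p' q' r' s' : V}
    (hG : IsStarOffWith G c w p q r s) (h : s(p, q) = s(p', q')) (h' : s(r, s) = s(r', s')) :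
    IsStarOffWith G c w p' q' r' s' := by
  intro u v
  rw [← h, ← h']
  exact hG u v

/-- The unicyclic graphs whose maximum degree is two less than the order. -/
theorem cases_of_degree_add_two_eq (c : V) (hpos : ∀ v, 1 ≤ G.degree v)
    (hE : G.edgeFinset.card = Fintype.card V) (hc : G.degree c + 2 = Fintype.card V) :
    ∃ w x, w ≠ c ∧ x ≠ c ∧ x ≠ w ∧
      ((∃ y, y ≠ c ∧ y ≠ w ∧ x ≠ y ∧ IsStarOffWith G c w x w x y) ∨
        (∃ y, y ≠ c ∧ y ≠ w ∧ x ≠ y ∧ IsStarOffWith G c w x w y w) ∨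
        (∃ y z, y ≠ c ∧ y ≠ w ∧ x ≠ y ∧ z ≠ c ∧ z ≠ w ∧ x ≠ z ∧ y ≠ z ∧
          IsStarOffWith G c w x w y z)) := by
  obtain ⟨w, x, p, q, hw, hx, hxw, hp, hq, hpq, hne, hG⟩ := exists_isStarOffWith G c hpos hE hc
  refine ⟨w, x, hw, hx, hxw, ?_⟩
  have hcT : c ∉ s(p, q) := by simp [hp.symm, hq.symm]
  have hdiag : ¬ s(p, q).IsDiag := by simpa using hpq
  -- The second edge contains `w` (quadrangle), contains `x` (pendant at a triangle), or avoids both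
  -- (triangle and a path of length two at `c`).
  by_cases hwm : w ∈ s(p, q)
  · obtain ⟨y, hy⟩ := Sym2.exists_eq_mk_of_mem hwm
    rw [hy] at hcT hdiag hne
    refine Or.inr (Or.inl ⟨y, ?_, by simpa using hdiag, ?_, hG.congr rfl hy⟩)
    · rintro rfl; simp at hcT
    · rintro rfl; exact hne rfl
  by_cases hxm : x ∈ s(p, q)
  · obtain ⟨y, hy⟩ := hxm
    rw [hy] at hcT hdiag hwm
    refine Or.inl ⟨y, ?_, ?_, by simpa using hdiag, hG.congr rfl hy⟩
    · rintro rfl; simp at hcT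
    · rintro rfl; simp at hwm
  · simp only [Sym2.mem_iff, not_or] at hwm hxm
    exact Or.inr (Or.inr ⟨p, q, hp, Ne.symm hwm.1, hxm.1, hq, Ne.symm hwm.2, hxm.2, hpq, hG⟩)

end Classification

/-! ### Identification of the extremal graphs and the case distinction. -/

section Extremal

variable {V : Type*} [Fintype V] {G : SimpleGraph V}

theorem IsStarWith.nonempty_iso_graphQ {c p q : V} (hG : IsStarWith G c p q) (hp : p ≠ c)
    (hq : q ≠ c) (hpq : p ≠ q) (n : ℕ) (hn : 3 ≤ n) (hV : Fintype.card V = n) :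
    Nonempty (G ≃g graphQ n 2) := by
  obtain ⟨e, he⟩ := exists_equiv_apply_eq ![c, p, q]
    ![(⟨0, by omega⟩ : Fin n), ⟨1, by omega⟩, ⟨n - 1, by omega⟩]
    (by intro i j; fin_cases i <;> fin_cases j <;> simp [hp, hq, hpq, hp.symm, hq.symm, hpq.symm])
    (by intro i j; fin_cases i <;> fin_cases j <;> simp <;> omega) (by simp [hV])
  refine hG.nonempty_iso (e := e) ?_
  have h0 := he 0; have h1 := he 1; have h2 := he 2
  simp at h0 h1 h2
  rw [h0, h1, h2]
  exact graphQ_isStarWith n hn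

theorem IsStarOffWith.nonempty_iso_graphQPrimeTwo {c w x y : V}
    (hG : IsStarOffWith G c w x w x y)
    (hw : w ≠ c) (hx : x ≠ c) (hy : y ≠ c) (hxw : x ≠ w) (hyw : y ≠ w) (hxy : x ≠ y)
    (n : ℕ) (hn : 5 ≤ n) (hV : Fintype.card V = n) : Nonempty (G ≃g graphQPrimeTwo n) := by
  obtain ⟨e, he⟩ := exists_equiv_apply_eq ![c, w, x, y]
    ![(⟨0, by omega⟩ : Fin n), ⟨n - 1, by omega⟩, ⟨1, by omega⟩, ⟨n - 2, by omega⟩]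
    (by intro i j; fin_cases i <;> fin_cases j <;> simp [hw, hx, hy, hxw, hyw, hxy, hw.symm,
      hx.symm, hy.symm, hxw.symm, hyw.symm, hxy.symm])
    (by intro i j; fin_cases i <;> fin_cases j <;> simp <;> omega) (by simp [hV])
  refine hG.nonempty_iso (e := e) ?_
  have h0 := he 0; have h1 := he 1; have h2 := he 2; have h3 := he 3
  simp at h0 h1 h2 h3
  rw [h0, h1, h2, h3]
  exact graphQPrimeTwo_isStarOffWith n hn

theorem IsStarOffWith.nonempty_iso_graphQStar {c w x y : V}
    (hG : IsStarOffWith G c w x w y w)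
    (hw : w ≠ c) (hx : x ≠ c) (hy : y ≠ c) (hxw : x ≠ w) (hyw : y ≠ w) (hxy : x ≠ y)
    (n : ℕ) (hn : 5 ≤ n) (hV : Fintype.card V = n) : Nonempty (G ≃g graphQStar n 2) := by
  obtain ⟨e, he⟩ := exists_equiv_apply_eq ![c, w, x, y]
    ![(⟨0, by omega⟩ : Fin n), ⟨n - 1, by omega⟩, ⟨1, by omega⟩, ⟨2, by omega⟩]
    (by intro i j; fin_cases i <;> fin_cases j <;> simp [hw, hx, hy, hxw, hyw, hxy, hw.symm,
      hx.symm, hy.symm, hxw.symm, hyw.symm, hxy.symm])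
    (by intro i j; fin_cases i <;> fin_cases j <;> simp <;> omega) (by simp [hV])
  refine hG.nonempty_iso (e := e) ?_
  have h0 := he 0; have h1 := he 1; have h2 := he 2; have h3 := he 3
  simp at h0 h1 h2 h3
  rw [h0, h1, h2, h3]
  exact graphQStar_isStarOffWith n hn

variable [DecidableEq V] [DecidableRel G.Adj]

theorem sombor_of_iso_graphQ (n : ℕ) (hn : 3 ≤ n) (h : Nonempty (G ≃g graphQ n 2)) :
    sombor G = √8 + ((n : ℝ) - 3) * √(((n : ℝ) - 1) ^ 2 + 1) + 2 * √(((n : ℝ) - 1) ^ 2 + 4) := by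
  classical
  obtain ⟨f⟩ := h
  rw [sombor_congr G _ f]
  exact (graphQ_isStarWith n hn).sombor_eq (by simp) (by simp; omega) (by simp; omega) n (by simp)

theorem sombor_of_iso_graphQPrimeTwo (n : ℕ) (hn : 5 ≤ n) (h : Nonempty (G ≃g graphQPrimeTwo n)) :
    sombor G = √10 + √13 + ((n : ℝ) - 4) * √(((n : ℝ) - 2) ^ 2 + 1)
          + √(((n : ℝ) - 2) ^ 2 + 4) + √(((n : ℝ) - 2) ^ 2 + 9) := by
  classical
  obtain ⟨f⟩ := h
  rw [sombor_congr G _ f]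
  refine (graphQPrimeTwo_isStarOffWith n hn).sombor_eq_of_common ?_ ?_ ?_ ?_ ?_ ?_ n (by simp) <;>
    simp only [ne_eq, Fin.mk.injEq] <;> omega

theorem sombor_of_iso_graphQStar (n : ℕ) (hn : 5 ≤ n) (h : Nonempty (G ≃g graphQStar n 2)) :
    sombor G = ((n : ℝ) - 4) * √(((n : ℝ) - 2) ^ 2 + 1) + 2 * √(((n : ℝ) - 2) ^ 2 + 4)
          + 2 * √8 := by
  classical
  obtain ⟨f⟩ := h
  rw [sombor_congr G _ f]
  refine (graphQStar_isStarOffWith n hn).sombor_eq_of_quadrangle ?_ ?_ ?_ ?_ ?_ ?_ n (by simp) <;>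
    simp only [ne_eq, Fin.mk.injEq] <;> omega

theorem IsUnicyclic.one_le_degree (hG : IsUnicyclic G) (hV : 2 ≤ Fintype.card V) (v : V) :
    1 ≤ G.degree v := by
  have : Nontrivial V := Fintype.one_lt_card_iff_nontrivial.1 hV
  exact hG.1.preconnected.degree_pos_of_nontrivial v

theorem IsUnicyclic.sum_degree (hG : IsUnicyclic G) :
    ∑ v, G.degree v = 2 * Fintype.card V := by
  rw [G.sum_degrees_eq_twice_card_edges, hG.2]

/-- A unicyclic graph of order at least five is one of the three extremal graphs, or its Sombor
index is less than that of `Q*`. -/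
theorem IsUnicyclic.cases (hG : IsUnicyclic G) (n : ℕ) (hn : 5 ≤ n) (hV : Fintype.card V = n) :
    Nonempty (G ≃g graphQ n 2) ∨ Nonempty (G ≃g graphQPrimeTwo n) ∨
      Nonempty (G ≃g graphQStar n 2) ∨
      sombor G < ((n : ℝ) - 4) * √(((n : ℝ) - 2) ^ 2 + 1) + 2 * √(((n : ℝ) - 2) ^ 2 + 4)
          + 2 * √8 := by
  have hpos := hG.one_le_degree (by omega)
  by_cases hsmall : ∀ v, G.degree v + 3 ≤ n
  · exact Or.inr (Or.inr (Or.inr (sombor_lt_of_degree_add_three_le G n hn hV hpos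
      (hV ▸ hG.sum_degree) hsmall)))
  push Not at hsmall
  obtain ⟨c, hc⟩ := hsmall
  have hlt := G.degree_lt_card_verts c
  rcases (by omega : G.degree c + 1 = Fintype.card V ∨ G.degree c + 2 = Fintype.card V) with h | h
  · obtain ⟨p, q, hp, hq, hpq, hS⟩ := exists_isStarWith G c hG.2 h
    exact Or.inl (hS.nonempty_iso_graphQ hp hq hpq n (by omega) hV)
  · obtain ⟨w, x, hw, hx, hxw, ⟨y, hy, hyw, hxy, hS⟩ | ⟨y, hy, hyw, hxy, hS⟩ |
      ⟨y, z, hy, hyw, hxy, hz, hzw, hxz, hyz, hS⟩⟩ := cases_of_degree_add_two_eq G c hpos hG.2 h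
    · exact Or.inr (Or.inl (hS.nonempty_iso_graphQPrimeTwo hw hx hy hxw hyw hxy n hn hV))
    · exact Or.inr (Or.inr (Or.inl (hS.nonempty_iso_graphQStar hw hx hy hxw hyw hxy n hn hV)))
    · refine Or.inr (Or.inr (Or.inr ?_))
      rw [hS.sombor_eq_of_tail hw hx hy hz hxw hyw hzw hxy hxz hyz n hV]
      have hnR : (5 : ℝ) ≤ n := by exact_mod_cast hn
      have := tail_lt_bound_three ((n : ℝ) - 2) (by linarith)
      ring_nf at this ⊢
      exact this

/-- Without a vertex of degree `n - 1`, order 3 contradicts the degree sum, and order 4 has all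
degrees at most 2, so `SO ≤ 4√8`. -/
theorem IsUnicyclic.iso_graphQ_or_sombor_lt_of_le_four (hG : IsUnicyclic G) (n : ℕ) (hn : 3 ≤ n)
    (hn' : n ≤ 4) (hV : Fintype.card V = n) :
    Nonempty (G ≃g graphQ n 2) ∨ sombor G <
      √8 + ((n : ℝ) - 3) * √(((n : ℝ) - 1) ^ 2 + 1) + 2 * √(((n : ℝ) - 1) ^ 2 + 4) := by
  have hsum := hG.sum_degree
  by_cases hsmall : ∀ v, G.degree v + 2 ≤ n
  · rcases (by omega : n = 3 ∨ n = 4) with rfl | rfl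
    · have := Finset.sum_le_sum (s := (Finset.univ : Finset V)) (f := fun v => G.degree v)
        (g := fun _ => 1)
        (fun v _ => by have := hsmall v; omega)
      rw [hsum] at this
      simp [hV] at this
    · refine Or.inr ?_
      have h := sombor_le_of_degree_le_two G 4 (hV ▸ hsum) (fun v => by have := hsmall v; omega)
      have h1 : (3.162 : ℝ) ≤ √10 := Real.le_sqrt_of_sq_le (by norm_num)
      have h2 : (3.605 : ℝ) ≤ √13 := Real.le_sqrt_of_sq_le (by norm_num)
      have h3 : √8 ≤ (2.829 : ℝ) := Real.sqrt_le_iff.2 ⟨by norm_num, by norm_num⟩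
      norm_num at *
      linarith
  · push Not at hsmall
    obtain ⟨c, hc⟩ := hsmall
    have hlt := G.degree_lt_card_verts c
    obtain ⟨p, q, hp, hq, hpq, hS⟩ := exists_isStarWith G c hG.2 (by omega)
    exact Or.inl (hS.nonempty_iso_graphQ hp hq hpq n (by omega) hV)

end Extremal

/-! ### The three bounds and their equality cases. -/

theorem corollary3p2 {V : Type*} [Fintype V] [DecidableEq V] (G : SimpleGraph V)
    [DecidableRel G.Adj] (n : ℕ) (hn : 3 ≤ n) (hV : Fintype.card V = n) (hG : IsUnicyclic G) :
    (sombor G ≤ √8 + ((n : ℝ) - 3) * √(((n : ℝ) - 1) ^ 2 + 1) + 2 * √(((n : ℝ) - 1) ^ 2 + 4) ∧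
      (sombor G = √8 + ((n : ℝ) - 3) * √(((n : ℝ) - 1) ^ 2 + 1) + 2 * √(((n : ℝ) - 1) ^ 2 + 4) ↔
        Nonempty (G ≃g graphQ n 2))) ∧
    (5 ≤ n → ¬ Nonempty (G ≃g graphQ n 2) →
      sombor G ≤ √10 + √13 + ((n : ℝ) - 4) * √(((n : ℝ) - 2) ^ 2 + 1)
          + √(((n : ℝ) - 2) ^ 2 + 4) + √(((n : ℝ) - 2) ^ 2 + 9) ∧
      (sombor G = √10 + √13 + ((n : ℝ) - 4) * √(((n : ℝ) - 2) ^ 2 + 1)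
          + √(((n : ℝ) - 2) ^ 2 + 4) + √(((n : ℝ) - 2) ^ 2 + 9) ↔
        Nonempty (G ≃g graphQPrimeTwo n))) ∧
    (5 ≤ n → ¬ Nonempty (G ≃g graphQ n 2) → ¬ Nonempty (G ≃g graphQPrimeTwo n) →
      sombor G ≤ ((n : ℝ) - 4) * √(((n : ℝ) - 2) ^ 2 + 1) + 2 * √(((n : ℝ) - 2) ^ 2 + 4)
          + 2 * √8 ∧
      (sombor G = ((n : ℝ) - 4) * √(((n : ℝ) - 2) ^ 2 + 1) + 2 * √(((n : ℝ) - 2) ^ 2 + 4)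
          + 2 * √8 ↔
        Nonempty (G ≃g graphQStar n 2))) := by

  have h12 : 5 ≤ n → √10 + √13 + ((n : ℝ) - 4) * √(((n : ℝ) - 2) ^ 2 + 1)
      + √(((n : ℝ) - 2) ^ 2 + 4) + √(((n : ℝ) - 2) ^ 2 + 9) <
      √8 + ((n : ℝ) - 3) * √(((n : ℝ) - 1) ^ 2 + 1) + 2 * √(((n : ℝ) - 1) ^ 2 + 4) := by
    intro h5
    have hnR : (5 : ℝ) ≤ n := by exact_mod_cast h5
    have := bound_two_lt_bound_one ((n : ℝ) - 2) (by linarith)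
    ring_nf at this ⊢
    exact this
  have h23 : ((n : ℝ) - 4) * √(((n : ℝ) - 2) ^ 2 + 1) + 2 * √(((n : ℝ) - 2) ^ 2 + 4) + 2 * √8 <
      √10 + √13 + ((n : ℝ) - 4) * √(((n : ℝ) - 2) ^ 2 + 1)
      + √(((n : ℝ) - 2) ^ 2 + 4) + √(((n : ℝ) - 2) ^ 2 + 9) := by
    have := bound_three_lt_bound_two ((n : ℝ) - 2)
    ring_nf at this ⊢
    exact this
  have hQ := sombor_of_iso_graphQ (G := G) n hn
  have hP := fun h5 => sombor_of_iso_graphQPrimeTwo (G := G) n h5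
  have hS := fun h5 => sombor_of_iso_graphQStar (G := G) n h5
  have hcases := hG.cases n
  refine ⟨?_, fun h5 hnQ => ?_, fun h5 hnQ hnP => ?_⟩
  · have key : Nonempty (G ≃g graphQ n 2) ∨ sombor G <
        √8 + ((n : ℝ) - 3) * √(((n : ℝ) - 1) ^ 2 + 1) + 2 * √(((n : ℝ) - 1) ^ 2 + 4) := by
      rcases le_or_gt n 4 with h4 | h5
      · exact hG.iso_graphQ_or_sombor_lt_of_le_four n hn h4 hV
      · have := h12 h5
        rcases hcases h5 hV with h | h | h | h
        · exact Or.inl h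
        · exact Or.inr (by linarith [hP h5 h])
        · exact Or.inr (by linarith [hS h5 h])
        · exact Or.inr (by linarith)
    rcases key with h | h
    · exact ⟨(hQ h).le, fun _ => h, hQ⟩
    · exact ⟨h.le, fun h' => absurd h' h.ne, hQ⟩
  · rcases hcases h5 hV with h | h | h | h
    · exact absurd h hnQ
    · exact ⟨(hP h5 h).le, fun _ => h, hP h5⟩
    · exact ⟨by linarith [hS h5 h], fun h' => by linarith [hS h5 h], hP h5⟩
    · exact ⟨by linarith, fun h' => by linarith, hP h5⟩
  · rcases hcases h5 hV with h | h | h | h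
    · exact absurd h hnQ
    · exact absurd h hnP
    · exact ⟨(hS h5 h).le, fun _ => h, hS h5⟩
    · exact ⟨h.le, fun h' => absurd h' h.ne, hS h5⟩
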